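/- Let $k$ be a field with $\operatorname{char} k \neq 2$. Order $\mathbb{Z}\oplus\mathbb{Z}$ lexicographically and let $\nu$ be the valuation on $k(X,Y)$ given by $\nu\bigl(\sum_{a,b} c_{a,b}X^aY^b\bigr)=\min\{(a,b) : c_{a,b}\neq 0\}$ for nonzero polynomials and $\nu(f/g)=\nu(f)-\nu(g)$. Extend $\nu$ to a valuation, again denoted $\nu$, on an algebraic closure $\Omega$ of $k(X,Y)$. Let $K\subseteq\Omega$ be the henselization of $(k(X,Y),\nu)$, that is, the absolute decomposition field: the set of elements of $\Omega$ that are separable over $k(X,Y)$ and fixed by every $\sigma\in\operatorname{Aut}(\Omega/k(X,Y))$ with $\nu\circ\sigma=\nu$. Put $L_1=K(\sqrt X)$, $L_2=K(\sqrt Y)$ and $L=L_1\cdot L_2$ inside $\Omega$, with the restrictions of $\nu$. For an algebraic extension $(M/N,\nu)$ of henselian valued fields let $p$ be the residue characteristic exponent of $N$ ($p=1$ in residue characteristic $0$). The extension is called tame if, for every finite subextension $E/N$, the index $[\nu E:\nu N]$ is prime to $p$, the residue field extension $E\nu/N\nu$ is separable, and $[E:N]=[\nu E:\nu N]\,[E\nu:N\nu]$.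 It is called unramified if it is tame and $\nu M=\nu N$, and ramified otherwise. Then $(K,\nu)$ is henselian, $L_1/K$ is a finite tame extension, $L_2/K$ is a finite extension, and $e_1=[\nu L_1:\nu K]=2$ and $e_2=[\nu L_2:\nu K]=2$, so that $e_1$ divides $e_2$; nevertheless $(L/L_2,\nu)$ is ramified. Hence the divisibility condition $e_1\mid e_2$ of Abhyankar's lemma does not suffice for $L/L_2$ to be unramified over a general henselian valued field. -/

import Mathlib

namespace LexValuation

/-- The exponent `(a, b)` of the monomial `X ^ a * Y ^ b`, as an element of `ℤ ⊕ ℤ` with the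
lexicographic order. -/
def lexExp (m : Fin 2 →₀ ℕ) : ℤ ×ₗ ℤ := toLex ((m 0 : ℤ), (m 1 : ℤ))

theorem lexExp_add (m n : Fin 2 →₀ ℕ) : lexExp (m + n) = lexExp m + lexExp n := by
  simp [lexExp, ← toLex_add]

theorem lexExp_injective : Function.Injective lexExp := by
  intro m n h
  have h' : ((m 0 : ℤ), (m 1 : ℤ)) = ((n 0 : ℤ), (n 1 : ℤ)) := toLex.injective h
  simp only [Prod.mk.injEq, Nat.cast_inj] at h'
  ext i
  fin_cases i
  · exact h'.1
  · exact h'.2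

/-- The map `∑ c_{a,b} X ^ a Y ^ b ↦ min {(a, b) | c_{a,b} ≠ 0}` on `k[X, Y]`, with value `⊤`
at `0`. -/
noncomputable def polyVal {k : Type*} [Field k] (f : MvPolynomial (Fin 2) k) :
    WithTop (ℤ ×ₗ ℤ) :=
  f.support.inf fun m => (lexExp m : WithTop (ℤ ×ₗ ℤ))

theorem polyVal_zero {k : Type*} [Field k] : polyVal (0 : MvPolynomial (Fin 2) k) = ⊤ := by
  simp [polyVal]

theorem exists_polyVal {k : Type*} [Field k] {f : MvPolynomial (Fin 2) k} (hf : f ≠ 0) :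
    ∃ m ∈ f.support, polyVal f = (lexExp m : WithTop (ℤ ×ₗ ℤ)) ∧
      ∀ n ∈ f.support, lexExp m ≤ lexExp n := by
  obtain ⟨m, hm, h⟩ := f.support.exists_min_image lexExp (MvPolynomial.support_nonempty.2 hf)
  refine ⟨m, hm, le_antisymm (Finset.inf_le hm) (Finset.le_inf fun n hn => ?_), h⟩
  exact WithTop.coe_le_coe.2 (h n hn)

theorem polyVal_one {k : Type*} [Field k] : polyVal (1 : MvPolynomial (Fin 2) k) = 0 := by
  obtain ⟨m, hm, h, -⟩ := exists_polyVal (one_ne_zero : (1 : MvPolynomial (Fin 2) k) ≠ 0)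
  have : m = 0 := by
    by_contra hne
    rw [MvPolynomial.mem_support_iff, MvPolynomial.coeff_one, if_neg (Ne.symm hne)] at hm
    exact hm rfl
  rw [h, this]
  rfl

theorem polyVal_add {k : Type*} [Field k] (f g : MvPolynomial (Fin 2) k) :
    min (polyVal f) (polyVal g) ≤ polyVal (f + g) := by
  classical
  refine Finset.le_inf fun m hm => ?_
  rcases Finset.mem_union.1 (MvPolynomial.support_add hm) with h | h
  · exact (min_le_left _ _).trans (Finset.inf_le h)
  · exact (min_le_right _ _).trans (Finset.inf_le h)

theorem polyVal_mul {k : Type*} [Field k] (f g : MvPolynomial (Fin 2) k) :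
    polyVal (f * g) = polyVal f + polyVal g := by
  classical
  by_cases hf : f = 0
  · simp [hf, polyVal_zero]
  by_cases hg : g = 0
  · simp [hg, polyVal_zero]
  obtain ⟨a, ha, hfa, hmina⟩ := exists_polyVal hf
  obtain ⟨b, hb, hgb, hminb⟩ := exists_polyVal hg
  rw [hfa, hgb, ← WithTop.coe_add, ← lexExp_add]
  apply le_antisymm
  · apply Finset.inf_le
    rw [MvPolynomial.mem_support_iff, MvPolynomial.coeff_mul,
      Finset.sum_eq_single (a, b)]
    · exact mul_ne_zero (MvPolynomial.mem_support_iff.1 ha) (MvPolynomial.mem_support_iff.1 hb)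
    · rintro ⟨c, d⟩ hcd hne
      by_contra h0
      have hc := hmina c (MvPolynomial.mem_support_iff.2 (left_ne_zero_of_mul h0))
      have hd := hminb d (MvPolynomial.mem_support_iff.2 (right_ne_zero_of_mul h0))
      have hs : lexExp c + lexExp d = lexExp a + lexExp b := by
        rw [← lexExp_add, ← lexExp_add, Finset.HasAntidiagonal.mem_antidiagonal.1 hcd]
      have h1 : lexExp c = lexExp a := by
        refine le_antisymm ?_ hc
        by_contra hlt
        exact absurd hs (add_lt_add_of_lt_of_le (not_le.1 hlt) hd).ne'
      have h2 : lexExp d = lexExp b := by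
        rw [h1] at hs
        exact add_left_cancel hs
      exact hne (Prod.ext (lexExp_injective h1) (lexExp_injective h2))
    · intro h
      exact absurd (Finset.HasAntidiagonal.mem_antidiagonal.2 (rfl : a + b = a + b)) h
  · refine Finset.le_inf fun m hm => ?_
    obtain ⟨c, hc, d, hd, rfl⟩ := Finset.mem_add.1 (MvPolynomial.support_mul f g hm)
    rw [lexExp_add, lexExp_add]
    exact WithTop.coe_le_coe.2 (add_le_add (hmina c hc) (hminb d hd))

/-- `polyVal` as an additive valuation on `k[X, Y]`. -/
noncomputable def polyAddVal (k : Type*) [Field k] :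
    AddValuation (MvPolynomial (Fin 2) k) (WithTop (ℤ ×ₗ ℤ)) :=
  AddValuation.of polyVal polyVal_zero polyVal_one polyVal_add polyVal_mul

/-- The field `k(X, Y)` of rational functions in two variables. -/
abbrev RatFun (k : Type*) [Field k] : Type _ := FractionRing (MvPolynomial (Fin 2) k)

theorem nonZeroDivisors_le_primeCompl (k : Type*) [Field k] :
    nonZeroDivisors (MvPolynomial (Fin 2) k) ≤
      (AddValuation.toValuation (polyAddVal k)).supp.primeCompl := by
  intro f hf h
  obtain ⟨m, -, hm, -⟩ := exists_polyVal (nonZeroDivisors.ne_zero hf)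
  have h' : polyVal f = ⊤ := h
  rw [hm] at h'
  exact WithTop.coe_ne_top h'

/-- The valuation `ν` of `k(X, Y)`: the extension of `polyVal` with `ν (f / g) = ν f - ν g`. -/
noncomputable def lexVal (k : Type*) [Field k] : AddValuation (RatFun k) (WithTop (ℤ ×ₗ ℤ)) :=
  AddValuation.ofValuation
    ((AddValuation.toValuation (polyAddVal k)).extendToLocalization
      (nonZeroDivisors_le_primeCompl k) (RatFun k))

theorem lexVal_algebraMap {k : Type*} [Field k] (f : MvPolynomial (Fin 2) k) :
    lexVal k (algebraMap _ (RatFun k) f) = polyVal f :=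
  Valuation.extendToLocalization_apply_map_apply _ (nonZeroDivisors_le_primeCompl k) _ f

theorem lexVal_div {k : Type*} [Field k] (f g : MvPolynomial (Fin 2) k) :
    lexVal k (algebraMap _ (RatFun k) f / algebraMap _ (RatFun k) g) =
      polyVal f - polyVal g := by
  rw [AddValuation.map_div, lexVal_algebraMap, lexVal_algebraMap]

/-- The element `X` of `k(X, Y)`. -/
noncomputable def varX (k : Type*) [Field k] : RatFun k :=
  algebraMap _ _ (MvPolynomial.X (0 : Fin 2) : MvPolynomial (Fin 2) k)

/-- The element `Y` of `k(X, Y)`. -/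
noncomputable def varY (k : Type*) [Field k] : RatFun k :=
  algebraMap _ _ (MvPolynomial.X (1 : Fin 2) : MvPolynomial (Fin 2) k)

end LexValuation

namespace ValuedField

variable {Γ : Type*} [AddCommGroup Γ] [LinearOrder Γ] [IsOrderedAddMonoid Γ]

/-- The value group `ν K = ν (K \ {0})`. -/
def valueGroup {K : Type*} [Field K] (v : AddValuation K (WithTop Γ)) : AddSubgroup Γ where
  carrier := {γ | ∃ x : K, v x = (γ : WithTop Γ)}
  zero_mem' := ⟨1, by simp⟩
  add_mem' := by
    rintro a b ⟨x, hx⟩ ⟨y, hy⟩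
    exact ⟨x * y, by rw [AddValuation.map_mul, hx, hy, WithTop.coe_add]⟩
  neg_mem' := by
    rintro a ⟨x, hx⟩
    exact ⟨x⁻¹, by rw [AddValuation.map_inv, hx]; rfl⟩

/-- The valuation ring `{x | 0 ≤ ν x}`. -/
abbrev valuationRing {K : Type*} [Field K] (v : AddValuation K (WithTop Γ)) :
    ValuationSubring K :=
  (AddValuation.toValuation v).valuationSubring

theorem mem_valuationRing {K : Type*} [Field K] (v : AddValuation K (WithTop Γ)) (x : K) :
    x ∈ valuationRing v ↔ 0 ≤ v x :=
  Iff.rfl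

/-- The residue field `K ν`. -/
abbrev residueField {K : Type*} [Field K] (v : AddValuation K (WithTop Γ)) : Type _ :=
  IsLocalRing.ResidueField (valuationRing v)

/-- `(K, ν)` is henselian: its valuation ring is a henselian local ring. -/
def IsHenselian {K : Type*} [Field K] (v : AddValuation K (WithTop Γ)) : Prop :=
  HenselianLocalRing (valuationRing v)

/-- The restriction of a valuation of `L` to a subfield `K`. -/
abbrev restrict (K : Type*) {L : Type*} [Field K] [Field L] [Algebra K L]
    (v : AddValuation L (WithTop Γ)) : AddValuation K (WithTop Γ) :=
  v.comap (algebraMap K L)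

instance hasExtension_restrict (K : Type*) {L : Type*} [Field K] [Field L] [Algebra K L]
    (v : AddValuation L (WithTop Γ)) :
    (AddValuation.toValuation (restrict K v)).HasExtension (AddValuation.toValuation v) :=
  ⟨Valuation.IsEquiv.refl⟩

/-- `w` on `L` extends `v` on `K` (up to an order preserving identification of the values). -/
def Extends {K L : Type*} [Field K] [Field L] [Algebra K L] {Δ : Type*} [AddCommGroup Δ]
    [LinearOrder Δ] [IsOrderedAddMonoid Δ]
    (v : AddValuation K (WithTop Δ)) (w : AddValuation L (WithTop Γ)) : Prop :=
  v.IsEquiv (restrict K w)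

/-- The ramification index `e = [ν L : ν K]` (it is `0` if the index is infinite). -/
noncomputable def ramificationIndex (K : Type*) {L : Type*} [Field K] [Field L] [Algebra K L]
    (v : AddValuation L (WithTop Γ)) : ℕ :=
  (valueGroup (restrict K v)).relIndex (valueGroup v)

/-- The residue degree `f = [L ν : K ν]` (it is `0` if the degree is infinite). -/
noncomputable def residueDegree (K : Type*) {L : Type*} [Field K] [Field L] [Algebra K L]
    (v : AddValuation L (WithTop Γ)) : ℕ :=
  Module.finrank (residueField (restrict K v)) (residueField v)

/-- An algebraic extension `(L / K, ν)` of henselian fields is tame if for each finite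
subextension `E / K` the index `[ν E : ν K]` is prime to the residue characteristic exponent
`p` (`p = 1` in residue characteristic `0`), the residue field extension is separable, and
`E / K` is defectless, that is, `[E : K] = e * f`. -/
def IsTame (K : Type*) {L : Type*} [Field K] [Field L] [Algebra K L]
    (v : AddValuation L (WithTop Γ)) : Prop :=
  ∀ E : IntermediateField K L, FiniteDimensional K E →
    (ringExpChar (residueField (restrict K v))).Coprime (ramificationIndex K (restrict E v)) ∧
    Algebra.IsSeparable (residueField (restrict K (restrict E v)))
      (residueField (restrict E v)) ∧
    Module.finrank K E = ramificationIndex K (restrict E v) * residueDegree K (restrict E v)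

/-- An algebraic extension `(L / K, ν)` of henselian fields is unramified if it is tame and
`ν L = ν K`. -/
def IsUnramified (K : Type*) {L : Type*} [Field K] [Field L] [Algebra K L]
    (v : AddValuation L (WithTop Γ)) : Prop :=
  IsTame K v ∧ valueGroup v = valueGroup (restrict K v)

/-- The decomposition group `{σ ∈ Aut (Ω / F) | w ∘ σ = w}`. -/
def decompositionGroup (F : Type*) {Ω : Type*} [Field F] [Field Ω] [Algebra F Ω]
    (w : AddValuation Ω (WithTop Γ)) : Subgroup (Ω ≃ₐ[F] Ω) where
  carrier := {σ | ∀ x, w (σ x) = w x}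
  one_mem' _ := rfl
  mul_mem' {σ τ} hσ hτ x := (hσ (τ x)).trans (hτ x)
  inv_mem' {σ} hσ x := by
    have h : σ (σ⁻¹ x) = x := σ.apply_symm_apply x
    rw [← hσ (σ⁻¹ x), h]

/-- The henselization of `(F, w|F)` inside the algebraic closure `Ω` of `F`, with respect to the
valuation `w` of `Ω`: the absolute decomposition field, that is, the fixed field of the
decomposition group in the separable closure of `F` in `Ω`. -/
noncomputable def henselization (F : Type*) {Ω : Type*} [Field F] [Field Ω] [Algebra F Ω]
    (w : AddValuation Ω (WithTop Γ)) : IntermediateField F Ω :=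
  IntermediateField.fixedField (decompositionGroup F w) ⊓ separableClosure F Ω

end ValuedField

/-! The value group of `K` is that of `k(X, Y)`, so under `ν` it is ℤ ⊕ ℤ. Adjoining `√X` adds the
class of `(1/2, 0)`, and adjoining `√Y` adds that of `(0, 1/2)`. Both quadratic steps have index 2,
but `ν(√X)` does not lie in `ν L₂ = νK ∪ (νK + ν(√Y))`. Thus the value group still grows from `L₂`
to `L`. Since 2 is a unit of the valuation ring, `L₁ / K` is tame.

The main work is that the decomposition field has the value group of the base field `F`. Valuation
rings of a Galois extension with the same restriction are conjugate, so for `x` in that field some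
`b ∈ F(x)` is a unit at `V` whose conjugates `σ b` with `σ x ≠ x` have value below 1. For suitable
`n`, `c = b ^ n * x` has the value of `x`, while no other conjugate of `c` does. The Newton polygon
of the minimal polynomial of `c` then has a segment of length one, and its slope is a quotient of
two coefficients in `F`.

The decomposition field is henselian because a simple residual root lifts to Ω uniquely, hence to an
element fixed by the decomposition group. -/

namespace ValuationSubring

/-! ### Elements of valuation rings as fractions of integral elements. -/

variable {P N : Type*} [Field P] [Field N] [Algebra P N]

theorem mul_mem_nonunits {V : ValuationSubring N} {x y : N} (hx : x ∈ V.nonunits) (hy : y ∈ V) :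
    x * y ∈ V.nonunits := by
  rw [mem_nonunits_iff] at *
  rw [map_mul]
  exact mul_lt_one_of_lt_of_le hx ((V.valuation_le_one_iff y).2 hy)

theorem not_mem_nonunits_of_sub_one_mem {V : ValuationSubring N} {u : N}
    (hu : u - 1 ∈ V.nonunits) : u ∉ V.nonunits := by
  intro h
  have h1 : (1 : N) ∈ V.nonunits := by simpa using sub_mem h hu
  simp [mem_nonunits_iff] at h1

theorem inv_mem_of_mem_of_not_mem_nonunits {V : ValuationSubring N} {u : N} (hu : u ∉ V.nonunits) :
    u⁻¹ ∈ V := by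
  rw [mem_nonunits_iff_or] at hu
  push Not at hu
  exact hu.2

theorem mem_nonunits_comap {V : ValuationSubring N} {x : P} :
    x ∈ (V.comap (algebraMap P N)).nonunits ↔ algebraMap P N x ∈ V.nonunits := by
  simp [mem_nonunits_iff_or, mem_comap]

/-- An algebraic element is a root of a polynomial with coefficients in a given valuation ring
whose last unit coefficient is `1`. -/
theorem exists_polynomial_aeval_eq_zero (A : ValuationSubring P) {y : N} (hy : IsAlgebraic P y) :
    ∃ (q : Polynomial P) (j : ℕ), Polynomial.aeval y q = 0 ∧ (∀ i, q.coeff i ∈ A) ∧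
      q.coeff j = 1 ∧ ∀ i, j < i → q.coeff i ∈ A.nonunits := by
  obtain ⟨q, hq, hqy⟩ := hy
  -- The lexicographic maximum selects the last among the coefficients of largest multiplicative
  -- value; dividing by it makes all later ones nonunits.
  obtain ⟨j, hj, hmax⟩ := q.support.exists_max_image
    (fun i => toLex (A.valuation (q.coeff i), i)) (Polynomial.support_nonempty.2 hq)
  have hj0 : q.coeff j ≠ 0 := Polynomial.mem_support_iff.1 hj
  have hv0 : A.valuation (q.coeff j) ≠ 0 := by simpa using hj0
  have hpos : 0 < A.valuation (q.coeff j) := zero_lt_iff.2 hv0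
  refine ⟨Polynomial.C (q.coeff j)⁻¹ * q, j, by simp [hqy], fun i => ?_, by simp [hj0],
    fun i hi => ?_⟩
  · rw [← A.valuation_le_one_iff, Polynomial.coeff_C_mul, map_mul, map_inv₀, inv_mul_le_one₀ hpos]
    by_cases hi : q.coeff i = 0
    · simp [hi]
    rcases Prod.Lex.toLex_le_toLex.1 (hmax i (Polynomial.mem_support_iff.2 hi)) with h | h
    · exact h.le
    · exact h.1.le
  · rw [mem_nonunits_iff, Polynomial.coeff_C_mul, map_mul, map_inv₀, inv_mul_lt_one₀ hpos]
    by_cases hi0 : q.coeff i = 0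
    · simpa [hi0] using hpos
    rcases Prod.Lex.toLex_le_toLex.1 (hmax i (Polynomial.mem_support_iff.2 hi0)) with h | h
    · exact h
    · exact absurd h.2 (not_le.2 hi)

/-- Every element of a valuation ring `V` which is algebraic over `P` is a fraction `t / u` where
`t` and `u` lie in all valuation rings containing `V ∩ P` and `u` is congruent to `1`. -/
theorem exists_mul_eq (V : ValuationSubring N) {y : N} (hy : y ∈ V) (halg : IsAlgebraic P y) :
    ∃ u t : N, y * u = t ∧ u - 1 ∈ V.nonunits ∧
      ∀ W : ValuationSubring N, V.comap (algebraMap P N) ≤ W.comap (algebraMap P N) →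
        u ∈ W ∧ t ∈ W := by
  by_cases hy0 : y = 0
  · exact ⟨1, 0, by simp [hy0], by simp,
      fun W _ => ⟨W.one_mem, W.zero_mem⟩⟩
  obtain ⟨q, j, hq, hA, hj, hjmax⟩ := exists_polynomial_aeval_eq_zero
    (V.comap (algebraMap P N)) halg
  set a : ℕ → N := fun i => algebraMap P N (q.coeff i) with ha
  have hsum : ∑ i ∈ Finset.range (j + (q.natDegree + 1)), a i * y ^ i = 0 := by
    rw [← hq, Polynomial.aeval_eq_sum_range' (n := j + (q.natDegree + 1)) (by lia)]
    simp [ha, Algebra.smul_def]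
  rw [Finset.sum_range_add] at hsum
  -- Splitting the relation at `j` writes both `u` and `y * u` either as polynomials in `y` or as
  -- polynomials in `y⁻¹`. Every valuation ring contains one of `y`, `y⁻¹`.
  set u : N := ∑ i ∈ Finset.range (q.natDegree + 1), a (j + i) * y ^ i with hu
  have hyu : y ^ j * u = ∑ i ∈ Finset.range (q.natDegree + 1), a (j + i) * y ^ (j + i) := by
    rw [hu, Finset.mul_sum]
    exact Finset.sum_congr rfl fun i _ => by ring
  have hu' : u = - ∑ i ∈ Finset.range j, a i * y⁻¹ ^ (j - i) := by
    apply mul_left_cancel₀ (pow_ne_zero j hy0)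
    rw [hyu, mul_neg, ← add_eq_zero_iff_eq_neg', ← hsum, Finset.mul_sum]
    congr 1
    refine Finset.sum_congr rfl fun i hi => ?_
    have : y ^ j = y ^ (j - i) * y ^ i := by
      rw [← pow_add, Nat.sub_add_cancel (Finset.mem_range.1 hi).le]
    rw [this, inv_pow]
    field_simp
  have ht' : y * u = - ∑ i ∈ Finset.range j, a i * y⁻¹ ^ (j - i - 1) := by
    rw [hu', mul_neg, Finset.mul_sum]
    congr 1
    refine Finset.sum_congr rfl fun i hi => ?_
    have hi' := Finset.mem_range.1 hi
    have : y⁻¹ ^ (j - i) = y⁻¹ ^ (j - i - 1) * y⁻¹ := by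
      rw [← pow_succ]; congr 1; lia
    rw [this]
    field_simp
  refine ⟨u, y * u, rfl, ?_, fun W hW => ?_⟩
  · rw [hu, Finset.sum_range_succ']
    have h0 : a (j + 0) * y ^ 0 = 1 := by simp [ha, hj]
    rw [h0, add_sub_cancel_right]
    refine sum_mem fun i _ => mul_mem_nonunits ?_ (pow_mem hy _)
    exact mem_nonunits_comap.1 (hjmax _ (by lia))
  · have haW : ∀ i, a i ∈ W := fun i => hW (hA i)
    rcases W.mem_or_inv_mem y with h | h
    · have huW : u ∈ W := sum_mem fun i _ => MulMemClass.mul_mem (haW _) (pow_mem h _)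
      exact ⟨huW, MulMemClass.mul_mem h huW⟩
    · rw [ht', hu']
      exact ⟨NegMemClass.neg_mem (sum_mem fun i _ => MulMemClass.mul_mem (haW _) (pow_mem h _)),
        NegMemClass.neg_mem (sum_mem fun i _ => MulMemClass.mul_mem (haW _) (pow_mem h _))⟩

end ValuationSubring

/-! ### Conjugacy of the extensions of a valuation ring. -/

namespace ValuationSubring

open scoped Pointwise

/-- The intersection of all valuation rings of `N` containing the subset `S` of `P`. -/
def closureOver {P : Type*} (N : Type*) [Field P] [Field N] [Algebra P N] (S : ValuationSubring P) :
    Subring N :=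
  ⨅ W : {W : ValuationSubring N // S ≤ W.comap (algebraMap P N)}, W.1.toSubring

variable {P N : Type*} [Field P] [Field N] [Algebra P N]

theorem mem_closureOver {S : ValuationSubring P} {x : N} :
    x ∈ closureOver N S ↔ ∀ W : ValuationSubring N, S ≤ W.comap (algebraMap P N) → x ∈ W := by
  simp [closureOver, Subring.mem_iInf]

theorem algEquiv_mem_closureOver {S : ValuationSubring P} (σ : N ≃ₐ[P] N) {x : N}
    (hx : x ∈ closureOver N S) : σ x ∈ closureOver N S := by
  rw [mem_closureOver] at *
  intro W hW
  refine hx (W.comap (σ : N →+* N)) fun p hp => ?_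
  simpa [mem_comap] using hW hp

/-- The Galois group acts on the intersection of all valuation rings over `S`. -/
@[reducible]
def closureOverAction (S : ValuationSubring P) :
    MulSemiringAction (N ≃ₐ[P] N) (closureOver N S) where
  smul σ x := ⟨σ x, algEquiv_mem_closureOver σ x.2⟩
  one_smul _ := rfl
  mul_smul _ _ _ := rfl
  smul_zero σ := Subtype.ext (map_zero σ)
  smul_add σ x y := Subtype.ext (map_add σ (x : N) y)
  smul_one σ := Subtype.ext (map_one σ)
  smul_mul σ x y := Subtype.ext (map_mul σ (x : N) y)

/-- The contraction of the maximal ideal of `V` to the intersection of all valuation rings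
over `S`. -/
def center (S : ValuationSubring P) (V : ValuationSubring N)
    (h : S ≤ V.comap (algebraMap P N)) : Ideal (closureOver N S) where
  carrier := {x | (x : N) ∈ V.nonunits}
  zero_mem' := V.nonunits.zero_mem
  add_mem' {a b} (ha : (a : N) ∈ V.nonunits) (hb : (b : N) ∈ V.nonunits) :=
    show (a : N) + b ∈ V.nonunits from AddMemClass.add_mem ha hb
  smul_mem' c x hx := by
    have := mul_mem_nonunits (V := V) hx (mem_closureOver.1 c.2 V h)
    rwa [mul_comm] at this

theorem center_isPrime (S : ValuationSubring P) (V : ValuationSubring N)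
    (h : S ≤ V.comap (algebraMap P N)) : (center S V h).IsPrime := by
  refine ⟨fun htop => ?_, fun {x y} hxy => ?_⟩
  · have h1 : (1 : closureOver N S) ∈ center S V h := htop ▸ Submodule.mem_top
    have h2 : (1 : N) ∈ V.nonunits := h1
    simp [mem_nonunits_iff] at h2
  · by_contra! hcon
    have h2 : (x : N) * y ∈ V.nonunits := hxy
    have hx' : (x : N) ∉ V.nonunits := hcon.1
    have := mul_mem_nonunits h2 (inv_mem_of_mem_of_not_mem_nonunits hx')
    have hx0 : (x : N) ≠ 0 := fun h0 => hx' (h0 ▸ V.nonunits.zero_mem)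
    refine hcon.2 (?_ : (y : N) ∈ V.nonunits)
    rwa [mul_comm (x : N), mul_assoc, mul_inv_cancel₀ hx0, mul_one] at this

/-- By `exists_mul_eq`, `V₁` consists of fractions of integral elements with denominator congruent
to 1. The hypothesis on centers keeps such denominators invertible in `V₂`. -/
theorem le_of_center [Algebra.IsAlgebraic P N] {V₁ V₂ : ValuationSubring N}
    (h : V₁.comap (algebraMap P N) ≤ V₂.comap (algebraMap P N))
    (hc : ∀ x ∈ closureOver N (V₁.comap (algebraMap P N)), x ∈ V₂.nonunits → x ∈ V₁.nonunits) :
    V₁ ≤ V₂ := by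
  intro y hy
  obtain ⟨u, t, hut, hu, hW⟩ := exists_mul_eq V₁ hy (Algebra.IsAlgebraic.isAlgebraic (R := P) y)
  have hu2 : u ∉ V₂.nonunits := fun hu2 =>
    not_mem_nonunits_of_sub_one_mem hu (hc u (mem_closureOver.2 fun W h1 => (hW W h1).1) hu2)
  have hu0 : u ≠ 0 := fun h0 => hu2 (h0 ▸ V₂.nonunits.zero_mem)
  rw [(eq_mul_inv_iff_mul_eq₀ hu0).2 hut]
  exact MulMemClass.mul_mem (hW V₂ h).2 (inv_mem_of_mem_of_not_mem_nonunits hu2)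

/-- Distinct valuation rings of an algebraic extension with the same restriction are separated by
an element which is integral over the restriction. -/
theorem exists_mem_nonunits_of_ne [Algebra.IsAlgebraic P N] {V₁ V₂ : ValuationSubring N}
    (h : V₁.comap (algebraMap P N) = V₂.comap (algebraMap P N)) (hne : V₁ ≠ V₂) :
    ∃ b : N, b ∉ V₁.nonunits ∧ b ∈ V₂.nonunits ∧
      ∀ W : ValuationSubring N, V₁.comap (algebraMap P N) ≤ W.comap (algebraMap P N) → b ∈ W := by
  by_contra! hcon
  have hle : V₁ ≤ V₂ := le_of_center (P := P) h.le fun u hu hu2 => by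
    by_contra hu1
    obtain ⟨W, h1, h2⟩ := hcon u hu1 hu2
    exact h2 (mem_closureOver.1 hu W h1)
  -- There is no strict inclusion over the same restriction: for `y ∈ V₂ \ V₁`, the denominator `u`
  -- of `y` is congruent to 1 at `V₂`, hence at `V₁`, yet `u = y⁻¹ * t` is a nonunit of `V₁`.
  refine hne (le_antisymm hle fun y hy => ?_)
  by_contra hy1
  have hz : y⁻¹ ∈ V₁.nonunits := (inv_mem_nonunits_iff _).2 (Or.inr hy1)
  obtain ⟨u, t, hut, hu, hW⟩ := exists_mul_eq V₂ hy (Algebra.IsAlgebraic.isAlgebraic (R := P) y)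
  have hy0 : y ≠ 0 := fun h0 => hy1 (h0 ▸ V₁.zero_mem)
  refine not_mem_nonunits_of_sub_one_mem (nonunits_le_nonunits.2 hle hu) ?_
  rw [show u = y⁻¹ * t by rw [← hut]; field_simp]
  exact mul_mem_nonunits hz (hW V₁ h.ge).2

/-- Valuation rings of a Galois extension with the same restriction are conjugate. -/
theorem exists_algEquiv_comap_eq [IsGalois P N] {V₁ V₂ : ValuationSubring N}
    (h : V₁.comap (algebraMap P N) = V₂.comap (algebraMap P N)) :
    ∃ τ : N ≃ₐ[P] N, V₂ = V₁.comap (τ : N →+* N) := by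
  set S := V₁.comap (algebraMap P N) with hS
  let act := closureOverAction (N := N) S
  -- With the discrete topology the action of the profinite Galois group is continuous, as
  -- stabilizers of algebraic elements are open. The group is then transitive on primes over the
  -- invariants, which all come from `P`.
  let : TopologicalSpace (closureOver N S) := ⊥
  have : DiscreteTopology (closureOver N S) := ⟨rfl⟩
  have : ContinuousSMul (N ≃ₐ[P] N) (closureOver N S) := by
    rw [continuousSMul_iff_stabilizer_isOpen]
    intro x
    convert stabilizer_isOpen_of_isIntegral (K := P) (L := N) (x : N)
    ext σ
    exact Subtype.ext_iff
  let Q₁ := center S V₁ le_rfl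
  let Q₂ := center S V₂ h.le
  have : Q₁.IsPrime := center_isPrime _ _ _
  have : Q₂.IsPrime := center_isPrime _ _ _
  let A := FixedPoints.subring (closureOver N S) (N ≃ₐ[P] N)
  have : Algebra.IsInvariant A (closureOver N S) (N ≃ₐ[P] N) :=
    ⟨fun b hb => ⟨⟨b, hb⟩, rfl⟩⟩
  have : SMulCommClass (N ≃ₐ[P] N) A (closureOver N S) := ⟨fun σ a b => by
    simp only [Algebra.smul_def, smul_mul']
    congr 1
    exact a.2 σ⟩
  obtain ⟨σ, hσ⟩ := Algebra.IsInvariant.exists_smul_of_under_eq_of_profinite (A := A)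
    (G := N ≃ₐ[P] N) Q₁ Q₂ (by
      ext ⟨a, ha⟩
      change (a : N) ∈ V₁.nonunits ↔ (a : N) ∈ V₂.nonunits
      obtain ⟨p, hp⟩ := (InfiniteGalois.mem_range_algebraMap_iff_fixed (k := P) (a : N)).2
        fun σ => congrArg Subtype.val (ha σ)
      rw [← hp, ← mem_nonunits_comap, ← mem_nonunits_comap, ← h])
  have key : ∀ x ∈ closureOver N S, x ∈ V₂.nonunits ↔ σ⁻¹ x ∈ V₁.nonunits := by
    intro x hx
    have h1 : (⟨x, hx⟩ : closureOver N S) ∈ Q₂ ↔ (⟨x, hx⟩ : closureOver N S) ∈ σ • Q₁ := by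
      rw [hσ]
    rw [Ideal.mem_pointwise_smul_iff_inv_smul_mem] at h1
    exact h1
  refine ⟨σ⁻¹, ?_⟩
  have hc : (V₁.comap ((σ⁻¹ : N ≃ₐ[P] N) : N →+* N)).comap (algebraMap P N) = S := by
    ext x
    simp [mem_comap, hS]
  have key' : ∀ x ∈ closureOver N S,
      x ∈ V₂.nonunits ↔ x ∈ (V₁.comap ((σ⁻¹ : N ≃ₐ[P] N) : N →+* N)).nonunits := by
    intro x hx
    rw [key x hx, mem_nonunits_iff_or, mem_nonunits_iff_or, mem_comap]
    simp
  apply le_antisymm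
  · exact le_of_center (P := P) (by rw [hc, h]) fun x hx => (key' x (by rwa [h])).2
  · exact le_of_center (P := P) (by rw [hc, h]) fun x hx => (key' x (by rwa [hc] at hx)).1

end ValuationSubring

namespace ValuationSubring

open Polynomial IntermediateField

/-! ### A Newton polygon segment of length one. -/

section NewtonPolygon

variable {N : Type*} [Field N]

theorem valuation_eq_one_of_residue_eq {V : ValuationSubring N} {a : V}
    (h : IsLocalRing.residue V a ≠ 0) : V.valuation (a : N) = 1 := by
  rw [← valuation_eq_one_iff]
  by_contra hu
  exact h ((IsLocalRing.residue_eq_zero_iff a).2 ((IsLocalRing.mem_maximalIdeal a).2 hu))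

/-- If all roots have value different from that of `c`, then after scaling by `c` the residue
polynomial is a monomial. -/
theorem exists_prod_eq_of_valuation_ne (V : ValuationSubring N) {c : N} (hc : c ≠ 0)
    (S : Multiset N) (hS : ∀ r ∈ S, V.valuation r ≠ V.valuation c) :
    ∃ (l : N) (g : V[X]) (s : ℕ), l ≠ 0 ∧
      (S.map fun r => C c * X - C r).prod = C l * g.map V.subtype ∧
      g.map (IsLocalRing.residue V) = X ^ s := by
  induction S using Multiset.induction_on with
  | empty => exact ⟨1, 1, 0, one_ne_zero, by simp, by simp⟩
  | cons r S ih =>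
    obtain ⟨l, g, s, hl, h1, h2⟩ := ih fun r hr => hS r (Multiset.mem_cons_of_mem hr)
    rw [Multiset.map_cons, Multiset.prod_cons, h1]
    have hc0 : 0 < V.valuation c := zero_lt_iff.2 (by simpa using hc)
    -- A root smaller than `c` gives the factor `X - r / c`, with residue `X`; a larger one gives `1
    -- - (c / r) X`, with residue 1. So `s` counts the smaller roots.
    rcases lt_or_gt_of_ne (hS r (Multiset.mem_cons_self r S)) with h | h
    · have hlt : V.valuation (r / c) < 1 := by rw [map_div₀]; exact (div_lt_one₀ hc0).2 h
      refine ⟨c * l, (X - C ⟨r / c, V.mem_of_valuation_le_one _ hlt.le⟩) * g, s + 1,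
        mul_ne_zero hc hl, ?_, ?_⟩
      · have : (C r : N[X]) = C c * C (r / c) := by rw [← C_mul, mul_div_cancel₀ _ hc]
        simp only [Polynomial.map_mul, Polynomial.map_sub, map_X, map_C, subtype_apply, C_mul, this]
        ring
      · have : IsLocalRing.residue V ⟨r / c, V.mem_of_valuation_le_one _ hlt.le⟩ = 0 := by
          rw [IsLocalRing.residue_eq_zero_iff, valuation_lt_one_iff]
          exact hlt
        rw [Polynomial.map_mul, h2, Polynomial.map_sub, map_X, map_C, this]
        simp [pow_succ']
    · have hr : r ≠ 0 := by
        rintro rfl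
        simp at h
      have hr0 : 0 < V.valuation r := hc0.trans h
      have hlt : V.valuation (c / r) < 1 := by rw [map_div₀]; exact (div_lt_one₀ hr0).2 h
      refine ⟨-r * l, (1 - C ⟨c / r, V.mem_of_valuation_le_one _ hlt.le⟩ * X) * g, s,
        mul_ne_zero (neg_ne_zero.2 hr) hl, ?_, ?_⟩
      · have : (C c : N[X]) = C r * C (c / r) := by rw [← C_mul, mul_div_cancel₀ _ hr]
        simp only [Polynomial.map_mul, Polynomial.map_sub, map_X, map_C, subtype_apply, C_mul, this,
          Polynomial.map_one, C_neg]
        ring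
      · have : IsLocalRing.residue V ⟨c / r, V.mem_of_valuation_le_one _ hlt.le⟩ = 0 := by
          rw [IsLocalRing.residue_eq_zero_iff, valuation_lt_one_iff]
          exact hlt
        rw [Polynomial.map_mul, h2, Polynomial.map_sub, Polynomial.map_mul, map_C, this]
        simp

/-- A simple root whose value differs from the values of all other roots has the value of an
element of the base field. -/
theorem exists_valuation_eq_of_simple_root {F : Type*} [Field F] [Algebra F N]
    (V : ValuationSubring N) {f : F[X]} (hf : f.Monic) (hs : (f.map (algebraMap F N)).Splits)
    {c : N} (hc : c ≠ 0) {S : Multiset N} (hroots : (f.map (algebraMap F N)).roots = c ::ₘ S)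
    (hS : ∀ r ∈ S, V.valuation r ≠ V.valuation c) :
    ∃ a : F, V.valuation (algebraMap F N a) = V.valuation c := by
  obtain ⟨l, g, s, hl, h1, h2⟩ := exists_prod_eq_of_valuation_ne V hc S hS
  have hv0 : V.valuation c ≠ 0 := by simpa using hc
  have hl0 : V.valuation l ≠ 0 := by simpa using hl
  have hcomp : (f.map (algebraMap F N)).comp (C c * X) =
      C (c * l) * ((X - 1) * g).map V.subtype := by
    conv_lhs => rw [hs.eq_prod_roots_of_monic (hf.map _), hroots]
    rw [Multiset.map_cons, Multiset.prod_cons, mul_comp, multiset_prod_comp, Multiset.map_map]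
    simp only [Function.comp_def, sub_comp, X_comp, C_comp, h1, Polynomial.map_mul,
      Polynomial.map_sub, map_X, Polynomial.map_one, C_mul]
    ring
  have hcoeff : ∀ i, algebraMap F N (f.coeff i) * c ^ i = c * l * (((X - 1) * g).coeff i : V) := by
    intro i
    have := congrArg (fun p => p.coeff i) hcomp
    rwa [comp_C_mul_X_coeff, coeff_map, coeff_C_mul, coeff_map, subtype_apply] at this
  -- Up to a constant, `f(cX)` reduces to `(X - 1) X ^ s`. Its coefficients at `s` and `s + 1`
  -- therefore have equal values before reduction, which determines the value of `c`.
  have hval : ∀ i, ((X ^ (s + 1) - X ^ s : (IsLocalRing.ResidueField V)[X]).coeff i ≠ 0) →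
      V.valuation (algebraMap F N (f.coeff i)) * V.valuation c ^ i =
        V.valuation c * V.valuation l := by
    intro i hi
    have hmap : ((X - 1) * g).map (IsLocalRing.residue V) = X ^ (s + 1) - X ^ s := by
      rw [Polynomial.map_mul, h2]; simp; ring
    rw [← hmap, coeff_map] at hi
    rw [← map_pow, ← map_mul, hcoeff, map_mul, map_mul, valuation_eq_one_of_residue_eq hi, mul_one]
  have e0 := hval s (by simp [coeff_X_pow])
  have e1 := hval (s + 1) (by simp [coeff_X_pow])
  have h0 : V.valuation (algebraMap F N (f.coeff (s + 1))) ≠ 0 := by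
    intro h0
    rw [h0, zero_mul] at e1
    exact mul_ne_zero hv0 hl0 e1.symm
  refine ⟨f.coeff s / f.coeff (s + 1), ?_⟩
  rw [map_div₀, map_div₀, div_eq_iff h0]
  apply mul_right_cancel₀ (pow_ne_zero s hv0)
  rw [e0, ← e1, pow_succ']
  ac_rfl

end NewtonPolygon

/-! ### Value group of the decomposition field. -/

section Decomposition

variable {F Ω : Type*} [Field F] [Field Ω] [Algebra F Ω] [IsAlgClosed Ω] [Algebra.IsAlgebraic F Ω]

/-- If `x` is fixed by the automorphisms preserving `V`, then any automorphism moving `x` also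
moves the restriction of `V` to `F(x)`. -/
theorem comap_adjoin_ne (V : ValuationSubring Ω) {x : Ω}
    (hfix : ∀ σ : Ω ≃ₐ[F] Ω, V.comap (σ : Ω →+* Ω) = V → σ x = x) (σ : Ω ≃ₐ[F] Ω)
    (hσ : σ x ≠ x) :
    V.comap (algebraMap F⟮x⟯ Ω) ≠ (V.comap (σ : Ω →+* Ω)).comap (algebraMap F⟮x⟯ Ω) := by
  intro h
  -- Passing to the perfect closure makes Ω Galois over `P`. Valuation rings extend uniquely to `P`,
  -- since each element has a power in `F(x)`.
  let P := perfectClosure F⟮x⟯ Ω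
  have : Algebra.IsAlgebraic F⟮x⟯ Ω := Algebra.IsAlgebraic.tower_top F⟮x⟯ (K := F)
  have : Algebra.IsAlgebraic P Ω := Algebra.IsAlgebraic.tower_top P (K := F⟮x⟯)
  have : IsAlgClosure P Ω := ⟨inferInstance, inferInstance⟩
  have : Normal P Ω := IsAlgClosure.normal P Ω
  have : IsGalois P Ω := {}
  have hP : V.comap (algebraMap P Ω) = (V.comap (σ : Ω →+* Ω)).comap (algebraMap P Ω) := by
    have hpow : ∀ (W : ValuationSubring Ω) (z : Ω) (n : ℕ), n ≠ 0 → (z ∈ W ↔ z ^ n ∈ W) := by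
      intro W z n hn
      rw [← W.valuation_le_one_iff, ← W.valuation_le_one_iff, map_pow, pow_le_one_iff hn]
    ext ⟨y, hy⟩
    obtain ⟨n, z, hz⟩ := mem_perfectClosure_iff.1 hy
    have hn : ringExpChar F⟮x⟯ ^ n ≠ 0 := pow_ne_zero _ (expChar_pos F⟮x⟯ _).ne'
    have h1 : z ∈ V.comap (algebraMap F⟮x⟯ Ω) ↔
        z ∈ (V.comap (σ : Ω →+* Ω)).comap (algebraMap F⟮x⟯ Ω) := by rw [h]
    rw [mem_comap, mem_comap (x := z), hz, ← hpow _ _ _ hn, ← hpow _ _ _ hn] at h1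
    exact h1
  obtain ⟨τ, hτ⟩ := exists_algEquiv_comap_eq (P := P) hP
  let τ' : Ω ≃ₐ[F] Ω := (τ.symm.restrictScalars F⟮x⟯).restrictScalars F
  have hx : τ.symm x = x := by
    have hxP : x ∈ P := (algebraMap F⟮x⟯ P ⟨x, mem_adjoin_simple_self F x⟩).2
    exact τ.symm.commutes ⟨x, hxP⟩
  refine hσ ?_
  -- `σ ∘ τ⁻¹` preserves `V`, hence fixes `x`; as `τ` fixes `x`, so does `σ`.
  have := hfix (τ'.trans σ) (by
    ext z
    have h2 : τ.symm z ∈ V.comap (σ : Ω →+* Ω) ↔ τ.symm z ∈ V.comap (τ : Ω →+* Ω) := by rw [hτ]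
    simp only [mem_comap] at h2 ⊢
    simpa [τ'] using h2)
  simpa [τ', hx] using this

/-- An element of `F(x)` which is a unit at `V` and a nonunit at the conjugates of `V` moved by
the automorphisms which move `x`. -/
theorem exists_mem_adjoin_valuation_lt_one (V : ValuationSubring Ω) {x : Ω}
    (hfix : ∀ σ : Ω ≃ₐ[F] Ω, V.comap (σ : Ω →+* Ω) = V → σ x = x) :
    ∃ b ∈ F⟮x⟯, V.valuation b = 1 ∧ ∀ σ : Ω ≃ₐ[F] Ω, σ x ≠ x → V.valuation (σ b) < 1 := by
  classical
  -- Each conjugate `x'` is handled by its own `b`. The bound by 1 on all conjugates of `b` lets the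
  -- product over all `x'` work for every `σ` at once.
  have key : ∀ x' : Ω, ∃ b ∈ F⟮x⟯, V.valuation b = 1 ∧
      (∀ σ : Ω ≃ₐ[F] Ω, V.valuation (σ b) ≤ 1) ∧
      ∀ σ : Ω ≃ₐ[F] Ω, σ x = x' → σ x ≠ x → V.valuation (σ b) < 1 := by
    intro x'
    by_cases hx' : ∃ σ : Ω ≃ₐ[F] Ω, σ x = x' ∧ σ x ≠ x
    · obtain ⟨σ, rfl, hσ⟩ := hx'
      obtain ⟨b, hb1, hb2, hb3⟩ := exists_mem_nonunits_of_ne (P := F) (N := F⟮x⟯)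
        (by ext z; simp [mem_comap, ← IsScalarTower.algebraMap_apply]) (comap_adjoin_ne V hfix σ hσ)
      have hb3' : ∀ τ : Ω ≃ₐ[F] Ω, V.valuation (τ b) ≤ 1 := by
        intro τ
        have := hb3 ((V.comap (τ : Ω →+* Ω)).comap (algebraMap F⟮x⟯ Ω)) (by
          intro z
          simp [mem_comap, ← IsScalarTower.algebraMap_apply])
        rw [V.valuation_le_one_iff]
        exact this
      refine ⟨b, b.2, ?_, hb3', fun τ hτ _ => ?_⟩
      · refine le_antisymm (hb3' 1) (not_lt.1 fun h => hb1 ?_)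
        exact mem_nonunits_comap.2 ((V.mem_nonunits_iff).2 h)
      · have hστ : σ b = τ b := by
          have : (σ : Ω →ₐ[F] Ω).comp F⟮x⟯.val = (τ : Ω →ₐ[F] Ω).comp F⟮x⟯.val :=
            adjoin_algHom_ext F (by simpa using hτ.symm)
          exact DFunLike.congr_fun this b
        rw [← hστ, ← V.mem_nonunits_iff]
        have := mem_nonunits_comap.1 hb2
        rw [mem_nonunits_iff_or, mem_comap] at this
        rw [mem_nonunits_iff_or]
        simpa using this
    · exact ⟨1, OneMemClass.one_mem _, by simp, by simp, fun σ h1 h2 => absurd ⟨σ, h1, h2⟩ hx'⟩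
  choose b hb h1 h2 h3 using key
  let R := ((minpoly F x).aroots Ω).toFinset
  refine ⟨∏ x' ∈ R, b x', prod_mem fun _ _ => hb _, ?_, fun σ hσ => ?_⟩
  · rw [map_prod]
    exact Finset.prod_eq_one fun _ _ => h1 _
  · have hmem : σ x ∈ R := by
      rw [Multiset.mem_toFinset, mem_aroots]
      refine ⟨minpoly.ne_zero (Algebra.IsIntegral.isIntegral x), ?_⟩
      rw [← AlgEquiv.coe_toAlgHom, aeval_algHom_apply, minpoly.aeval, map_zero]
    rw [map_prod, map_prod, ← Finset.mul_prod_erase _ _ hmem]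
    exact mul_lt_one_of_lt_of_le (h3 _ σ rfl hσ) (Finset.prod_le_one' fun _ _ => h2 _ σ)

/-- The decomposition field has the same value group as the base field. -/
theorem exists_valuation_algebraMap_eq (V : ValuationSubring Ω) {x : Ω} (hx0 : x ≠ 0)
    (hsep : IsSeparable F x)
    (hfix : ∀ σ : Ω ≃ₐ[F] Ω, V.comap (σ : Ω →+* Ω) = V → σ x = x) :
    ∃ a : F, V.valuation (algebraMap F Ω a) = V.valuation x := by
  classical
  obtain ⟨b, hb, hb1, hblt⟩ := exists_mem_adjoin_valuation_lt_one V hfix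
  have hb0 : b ≠ 0 := by rintro rfl; simp at hb1
  have hnormal : Normal F Ω := by
    have : IsAlgClosure F Ω := ⟨inferInstance, inferInstance⟩
    exact IsAlgClosure.normal F Ω
  let R := (((minpoly F b).aroots Ω).toFinset ×ˢ ((minpoly F x).aroots Ω).toFinset).filter
    fun r => V.valuation r.1 < 1 ∧ r.1 ≠ 0
  have hmemR : ∀ (σ : Ω ≃ₐ[F] Ω) (y : Ω), σ y ∈ ((minpoly F y).aroots Ω).toFinset := by
    intro σ y
    rw [Multiset.mem_toFinset, mem_aroots]
    refine ⟨minpoly.ne_zero (Algebra.IsIntegral.isIntegral y), ?_⟩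
    rw [← AlgEquiv.coe_toAlgHom, aeval_algHom_apply, minpoly.aeval, map_zero]
  -- The values of `b' ^ n * x'` strictly decrease in `n`, so each of the finitely many pairs of
  -- conjugates excludes at most one exponent.
  have hfin : (⋃ r ∈ R, {n : ℕ | V.valuation (r.1 ^ n * r.2) = V.valuation x}).Finite := by
    refine R.finite_toSet.biUnion fun r hr => Set.Subsingleton.finite ?_
    have hr' := (Finset.mem_filter.1 hr).2
    have hr2 : 0 < V.valuation r.1 := zero_lt_iff.2 (by simpa using hr'.2)
    intro m hm n hn
    simp only [Set.mem_ofPred_eq] at hm hn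
    rw [← hm, map_mul, map_mul, map_pow, map_pow] at hn
    have hr0 : V.valuation r.2 ≠ 0 := by
      intro h0
      rw [map_mul, h0, mul_zero] at hm
      exact hx0 (by simpa using hm.symm)
    exact (pow_right_strictAnti₀ hr2 hr'.1).injective (mul_right_cancel₀ hr0 hn).symm
  obtain ⟨n, hn⟩ := hfin.exists_notMem
  simp only [Set.mem_iUnion, not_exists, Set.mem_ofPred_eq] at hn
  set c := b ^ n * x with hc
  have hc0 : c ≠ 0 := mul_ne_zero (pow_ne_zero _ hb0) hx0
  have hcv : V.valuation c = V.valuation x := by rw [hc, map_mul, map_pow, hb1, one_pow, one_mul]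
  have hcF : c ∈ F⟮x⟯ := MulMemClass.mul_mem (pow_mem hb n) (mem_adjoin_simple_self F x)
  have hcsep : IsSeparable F c := mem_separableClosure_iff.1
    ((adjoin_simple_le_iff (K := separableClosure F Ω)).2 (mem_separableClosure_iff.2 hsep) hcF)
  have hcint : IsIntegral F c := Algebra.IsIntegral.isIntegral c
  have hcroot : c ∈ ((minpoly F c).map (algebraMap F Ω)).roots := by
    rw [mem_roots (map_ne_zero (minpoly.ne_zero hcint)), IsRoot, eval_map_algebraMap,
      minpoly.aeval]
  obtain ⟨S, hS⟩ := Multiset.exists_cons_of_mem hcroot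
  have hnodup : (c ::ₘ S).Nodup := hS ▸ nodup_roots (Polynomial.Separable.map hcsep)
  rw [← hcv]
  refine exists_valuation_eq_of_simple_root V (minpoly.monic hcint) (IsAlgClosed.splits _) hc0 hS
    fun r hr => ?_
  have hrc : r ≠ c := by
    rintro rfl
    exact (Multiset.nodup_cons.1 hnodup).1 hr
  have hrroot : aeval r (minpoly F c) = 0 := by
    have : r ∈ ((minpoly F c).map (algebraMap F Ω)).roots := hS ▸ Multiset.mem_cons_of_mem hr
    exact ((mem_aroots).1 this).2
  obtain ⟨σ, rfl⟩ := minpoly.exists_algEquiv_of_root' hcint.isAlgebraic hrroot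
  have hσx : σ x ≠ x := by
    intro hσ
    have : (σ : Ω →ₐ[F] Ω).comp F⟮x⟯.val = F⟮x⟯.val :=
      adjoin_algHom_ext F (by simpa using hσ)
    exact hrc (DFunLike.congr_fun this ⟨c, hcF⟩)
  rw [hcv, hc, map_mul, map_pow]
  exact hn (σ b, σ x) (Finset.mem_filter.2 ⟨Finset.mem_product.2 ⟨hmemR σ b, hmemR σ x⟩,
    hblt σ hσx, by simpa using hb0⟩)

end Decomposition

end ValuationSubring

namespace ValuedField

open Polynomial

variable {Γ : Type*} [AddCommGroup Γ] [LinearOrder Γ] [IsOrderedAddMonoid Γ]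

/-! ### The absolute decomposition field is henselian with unchanged value group. -/

section Henselization

variable {F Ω : Type*} [Field F] [Field Ω] [Algebra F Ω]

theorem valuation_eq_iff (w : AddValuation Ω (WithTop Γ)) {x y : Ω} :
    (valuationRing w).valuation x = (valuationRing w).valuation y ↔ w x = w y :=
  (Valuation.isEquiv_valuation_valuationSubring (AddValuation.toValuation w)).eq_iff.symm

theorem mem_nonunits_iff (w : AddValuation Ω (WithTop Γ)) {x : Ω} :
    x ∈ (valuationRing w).nonunits ↔ 0 < w x := by
  rw [ValuationSubring.mem_nonunits_iff]
  have h := (Valuation.isEquiv_valuation_valuationSubring (AddValuation.toValuation w)).lt_iff_lt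
    (x := x) (y := 1)
  rw [map_one, map_one] at h
  exact h.symm

/-- An automorphism preserving the valuation ring preserves the valuation. -/
theorem mem_decompositionGroup_of_comap_eq [Algebra.IsAlgebraic F Ω]
    (w : AddValuation Ω (WithTop Γ)) {σ : Ω ≃ₐ[F] Ω}
    (h : (valuationRing w).comap (σ : Ω →+* Ω) = valuationRing w) :
    σ ∈ decompositionGroup F w := by
  have hle : ∀ x y, w (σ x) < w (σ y) ↔ w x < w y := by
    have heq : (AddValuation.toValuation w).IsEquiv
        ((AddValuation.toValuation w).comap (σ : Ω →+* Ω)) := by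
      rw [Valuation.isEquiv_iff_valuationSubring]
      exact h.symm
    exact fun x y => heq.lt_iff_lt.symm
  intro x
  -- The orbit of `x` lies among the roots of its minimal polynomial, so it is finite. If `w (σ x) ≠
  -- w x`, order preservation would make `w` strictly monotone along it.
  have hfin : ¬ Function.Injective fun n : ℕ => σ^[n] x := by
    intro hinj
    have hmem : ∀ n : ℕ, σ^[n] x ∈ ((minpoly F x).rootSet Ω) := by
      have hne := minpoly.ne_zero (Algebra.IsIntegral.isIntegral (R := F) x)
      intro n
      induction n with
      | zero => exact mem_rootSet.2 ⟨hne, minpoly.aeval F x⟩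
      | succ n ih =>
        rw [Function.iterate_succ_apply']
        refine mem_rootSet.2 ⟨hne, ?_⟩
        have h1 := aeval_algHom_apply (σ : Ω →ₐ[F] Ω) (σ^[n] x) (minpoly F x)
        rw [(mem_rootSet.1 ih).2, map_zero] at h1
        exact h1
    exact Set.infinite_of_injective_forall_mem hinj hmem (rootSet_finite _ _)
  by_contra hne
  refine hfin (Function.Injective.of_comp (f := w) ?_)
  rcases lt_or_gt_of_ne hne with hlt | hlt
  · refine (strictAnti_nat_of_succ_lt fun n => ?_).injective
    induction n with
    | zero => exact hlt
    | succ n ih =>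
      simp only [Function.comp_apply, Function.iterate_succ_apply'] at ih ⊢
      exact (hle _ _).2 ih
  · refine (strictMono_nat_of_lt_succ fun n => ?_).injective
    induction n with
    | zero => exact hlt
    | succ n ih =>
      simp only [Function.comp_apply, Function.iterate_succ_apply'] at ih ⊢
      exact (hle _ _).2 ih

/-- The henselization has the same value group as the base field. -/
theorem exists_algebraMap_eq_of_mem_henselization [IsAlgClosed Ω] [Algebra.IsAlgebraic F Ω]
    (w : AddValuation Ω (WithTop Γ)) {x : Ω} (hx : x ∈ henselization F w) (hx0 : x ≠ 0) :
    ∃ a : F, w (algebraMap F Ω a) = w x := by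
  obtain ⟨h1, h2⟩ := IntermediateField.mem_inf.1 hx
  obtain ⟨a, ha⟩ := ValuationSubring.exists_valuation_algebraMap_eq (valuationRing w) hx0
    (mem_separableClosure_iff.1 h2) fun σ hσ =>
      (IntermediateField.mem_fixedField_iff _ _).1 h1 σ (mem_decompositionGroup_of_comap_eq w hσ)
  exact ⟨a, (valuation_eq_iff w).1 ha⟩

/-- Expanding `f` at `r` gives `0 = (f'(r) + k (s - r)) (s - r)`, and the first factor is congruent
to the unit `f'(a)`. -/
theorem eq_of_isRoot_of_sub_mem {R : Type*} [CommRing R] [IsLocalRing R] {f : R[X]} {a r s : R}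
    (ha : IsUnit (f.derivative.eval a)) (hr : f.IsRoot r) (hs : f.IsRoot s)
    (hra : r - a ∈ IsLocalRing.maximalIdeal R) (hsa : s - a ∈ IsLocalRing.maximalIdeal R) :
    s = r := by
  obtain ⟨k, hk⟩ := f.binomExpansion r (s - r)
  rw [add_sub_cancel, hr.eq_zero, hs.eq_zero] at hk
  have hsr : s - r ∈ IsLocalRing.maximalIdeal R := by
    simpa using sub_mem hsa hra
  have hu : IsUnit (f.derivative.eval r + k * (s - r)) := by
    by_contra hu
    have h1 : f.derivative.eval r + k * (s - r) ∈ IsLocalRing.maximalIdeal R := hu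
    have h2 : f.derivative.eval r ∈ IsLocalRing.maximalIdeal R := by
      simpa using sub_mem h1 (Ideal.mul_mem_left _ k hsr)
    have h3 : f.derivative.eval r - f.derivative.eval a ∈ IsLocalRing.maximalIdeal R :=
      Ideal.mem_of_dvd _ (sub_dvd_eval_sub r a _) hra
    exact (by simpa using sub_mem h2 h3 : f.derivative.eval a ∈ IsLocalRing.maximalIdeal R) ha
  have h0 : (f.derivative.eval r + k * (s - r)) * (s - r) = 0 := by
    rw [hk]; ring
  exact sub_eq_zero.1 ((hu.mul_right_eq_zero).1 h0)

/-- In a valuation ring of an algebraically closed field, roots modulo the maximal ideal lift. -/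
theorem exists_isRoot_of_eval_mem [IsAlgClosed Ω] (V : ValuationSubring Ω) {f : V[X]} (hf : f.Monic)
    {a : V} (ha : f.eval a ∈ IsLocalRing.maximalIdeal V) :
    ∃ r : V, f.IsRoot r ∧ r - a ∈ IsLocalRing.maximalIdeal V := by
  have hs := (IsAlgClosed.splits (f.map V.subtype)).eq_prod_roots_of_monic (hf.map _)
  -- `f(a)` is the product of the `a - r` over the roots; its value is below 1, so that of some
  -- factor is.
  have hex : ∃ r ∈ (f.map V.subtype).roots, V.valuation ((a : Ω) - r) < 1 := by
    by_contra! hcon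
    have hval := congrArg (fun p => V.valuation (p.eval (a : Ω))) hs
    have h1 : (f.map V.subtype).eval (a : Ω) = (f.eval a : V) := by
      rw [← ValuationSubring.subtype_apply a, eval_map_apply]
      rfl
    simp only [h1, eval_multiset_prod, Multiset.map_map, Function.comp_def, eval_sub, eval_X,
      eval_C] at hval
    have h2 := (V.valuation_lt_one_iff _).1 ha
    rw [hval] at h2
    refine absurd h2 (not_lt.2 ?_)
    refine Multiset.prod_induction (fun x => 1 ≤ V.valuation x) _ (fun x y hx hy => ?_) (by simp) ?_
    · rw [map_mul]; exact one_le_mul_of_one_le_of_one_le hx hy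
    · intro x hx
      obtain ⟨r, hr, rfl⟩ := Multiset.mem_map.1 hx
      exact hcon r hr
  obtain ⟨r, hr, hlt⟩ := hex
  have hrV : r ∈ V := by
    have := sub_mem a.2 (V.mem_of_valuation_le_one _ hlt.le)
    simpa using this
  refine ⟨⟨r, hrV⟩, ?_, ?_⟩
  · have := (mem_roots'.1 hr).2
    exact IsRoot.of_map (f := V.subtype) (x := ⟨r, hrV⟩) this V.subtype_injective
  · rw [V.valuation_lt_one_iff]
    rw [Valuation.map_sub_swap] at hlt
    exact hlt

/-- The absolute decomposition field is henselian. -/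
theorem isHenselian_henselization [IsAlgClosed Ω] (w : AddValuation Ω (WithTop Γ)) :
    IsHenselian (restrict (henselization F w) w) := by
  set K := henselization F w with hK
  let O := valuationRing (restrict K w)
  let V := valuationRing w
  let ι : O →+* V := ((algebraMap K Ω).comp O.subtype).codRestrict V.toSubring fun x => x.2
  have hloc : ∀ x : O, x ∈ IsLocalRing.maximalIdeal O ↔ ι x ∈ IsLocalRing.maximalIdeal V := by
    intro x
    rw [← ValuationSubring.coe_mem_nonunits_iff, ← ValuationSubring.coe_mem_nonunits_iff,
      mem_nonunits_iff, mem_nonunits_iff]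
    rfl
  refine { is_henselian := fun f hf a ha hda => ?_ }
  have ha' : (f.map ι).eval (ι a) ∈ IsLocalRing.maximalIdeal V := by
    rw [eval_map_apply]
    exact (hloc _).1 ha
  have hda' : IsUnit ((f.map ι).derivative.eval (ι a)) := by
    rw [derivative_map, eval_map_apply]
    exact hda.map ι
  obtain ⟨r, hr, hra⟩ := exists_isRoot_of_eval_mem V (hf.map ι) ha'
  let fK : K[X] := f.map O.subtype
  have hcomp : (f.map ι).map V.subtype = fK.map (algebraMap K Ω) := by
    rw [Polynomial.map_map, Polynomial.map_map]
    rfl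
  have hrK : aeval (r : Ω) fK = 0 := by
    rw [← eval_map_algebraMap, ← hcomp, ← ValuationSubring.subtype_apply r, eval_map_apply,
      hr.eq_zero, map_zero]
  -- An inseparable minimal polynomial would have zero derivative and force `f'(r) = 0`, whereas
  -- `f'(r)` is congruent to the unit `f'(a)`.
  have hrsep : IsSeparable K (r : Ω) := by
    have hint : IsIntegral K (r : Ω) := ⟨fK, hf.map _, hrK⟩
    rw [IsSeparable, separable_iff_derivative_ne_zero (minpoly.irreducible hint)]
    intro h0
    obtain ⟨q, hq⟩ := minpoly.dvd K (r : Ω) hrK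
    have h1 : aeval (r : Ω) (derivative fK) = 0 := by
      rw [hq, derivative_mul, h0]; simp
    have h2 : IsUnit ((f.map ι).derivative.eval r) := by
      by_contra hu
      have h3 := sub_dvd_eval_sub r (ι a) (f.map ι).derivative
      have h4 := sub_mem (show (f.map ι).derivative.eval r ∈ IsLocalRing.maximalIdeal V from hu)
        (Ideal.mem_of_dvd _ h3 hra)
      rw [sub_sub_cancel] at h4
      exact h4 hda'
    have h5 : (((f.map ι).derivative.eval r : V) : Ω) = 0 := by
      rw [← h1, ← eval_map_algebraMap, ← derivative_map, ← hcomp, derivative_map (p := f.map ι),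
        ← ValuationSubring.subtype_apply r, eval_map_apply]
      rfl
    exact h2.ne_zero (Subtype.ext h5)
  have hKsep : Algebra.IsSeparable F K :=
    le_separableClosure_iff F Ω K |>.1 inf_le_right
  have hrmem : (r : Ω) ∈ K := by
    refine IntermediateField.mem_inf.2 ⟨(IntermediateField.mem_fixedField_iff _ _).2 fun σ hσ => ?_,
      mem_separableClosure_iff.2 (IsSeparable.of_algebra_isSeparable_of_isSeparable F hrsep)⟩
    have hσK : ∀ z : K, σ z = z := fun z =>
      (IntermediateField.mem_fixedField_iff _ _).1 (IntermediateField.mem_inf.1 z.2).1 σ hσ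
    have hσr : σ r ∈ V := by
      have h1 : w (σ r) = w r := hσ r
      change 0 ≤ w (σ r)
      rw [h1]
      exact r.2
    have hroot : (f.map ι).IsRoot ⟨σ r, hσr⟩ := by
      refine IsRoot.of_map (f := V.subtype) ?_ V.subtype_injective
      rw [hcomp]
      change (fK.map (algebraMap K Ω)).eval (σ r) = 0
      let σK : Ω →ₐ[K] Ω := { (σ : Ω →+* Ω) with commutes' := hσK }
      rw [eval_map_algebraMap]
      have h2 := aeval_algHom_apply σK (r : Ω) fK
      rw [hrK, map_zero] at h2
      exact h2
    have hsub : (⟨σ r, hσr⟩ : V) - ι a ∈ IsLocalRing.maximalIdeal V := by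
      rw [← ValuationSubring.coe_mem_nonunits_iff, mem_nonunits_iff] at hra ⊢
      have h1 : w (σ ((r : Ω) - ι a)) = w ((r : Ω) - ι a) := hσ _
      rw [map_sub, show σ (ι a : Ω) = ι a from hσK a.1] at h1
      change 0 < w (σ r - ι a)
      rw [h1]
      exact hra
    -- `σ r` is again a root congruent to `a`, so uniqueness gives `σ r = r`.
    exact congrArg Subtype.val (eq_of_isRoot_of_sub_mem hda' hr hroot hra hsub)
  have hι : Function.Injective ι := fun x y hxy =>
    Subtype.ext (Subtype.ext (congrArg (fun z : V => (z : Ω)) hxy))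
  refine ⟨⟨⟨r, hrmem⟩, r.2⟩, ?_, ?_⟩
  · exact IsRoot.of_map (f := ι) hr hι
  · rw [hloc, map_sub]
    exact hra

end Henselization

end ValuedField

namespace ValuedField

variable {Γ : Type*} [AddCommGroup Γ] [LinearOrder Γ] [IsOrderedAddMonoid Γ]

/-! ### Quadratic extensions generated by an element of new value. -/

section Quadratic

variable {K L : Type*} [Field K] [Field L] [Algebra K L]

theorem exists_coe_eq {w : AddValuation L (WithTop Γ)} {x : L} (hx : x ≠ 0) :
    ∃ γ : Γ, w x = γ := by
  obtain ⟨γ, hγ⟩ := WithTop.ne_top_iff_exists.1 ((AddValuation.ne_top_iff w).2 hx)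
  exact ⟨γ, hγ.symm⟩

theorem coe_mem_valueGroup_of_add_eq {w : AddValuation L (WithTop Γ)} {x y : L} {γ : Γ}
    (hx : w x = γ) {b : L} (hb : b ≠ 0) (h : w (b * x) = w y) (hy : y ≠ 0) :
    ∃ c d : Γ, w b = c ∧ w y = d ∧ γ = d - c := by
  obtain ⟨c, hc⟩ := exists_coe_eq (w := w) hb
  obtain ⟨d, hd⟩ := exists_coe_eq (w := w) hy
  refine ⟨c, d, hc, hd, ?_⟩
  rw [AddValuation.map_mul, hc, hd, hx, ← WithTop.coe_add, WithTop.coe_inj] at h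
  rw [← h]
  abel

variable {v : AddValuation L (WithTop Γ)} {s : L} {ξ : Γ}

/-- For nonzero `a`, `b`, the values of `a` and `b * s` lie in different cosets of `νK`, so no
cancellation can occur. -/
theorem map_add_mul_eq_min (hξ : v s = ξ) (hξK : ξ ∉ valueGroup (restrict K v)) (a b : K) :
    v (algebraMap K L a + algebraMap K L b * s) =
      min (v (algebraMap K L a)) (v (algebraMap K L b * s)) := by
  by_cases hb : b = 0
  · simp [hb]
  by_cases ha : a = 0
  · simp [ha]
  refine AddValuation.map_add_of_distinct_val v fun h => hξK ?_
  obtain ⟨c, d, hc, hd, rfl⟩ := coe_mem_valueGroup_of_add_eq hξ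
    ((map_ne_zero (algebraMap K L)).2 hb) h.symm ((map_ne_zero (algebraMap K L)).2 ha)
  exact sub_mem ⟨a, hd⟩ ⟨b, hc⟩

/-- This yields `νL = νK ∪ (νK + ξ)`. It gives the index 2, and later excludes `ν(√X)` from `ν L₂`.
-/
theorem mem_or_sub_mem_valueGroup
    (hspan : ∀ y : L, ∃ a b : K, y = algebraMap K L a + algebraMap K L b * s)
    (hξ : v s = ξ) (hξK : ξ ∉ valueGroup (restrict K v)) {γ : Γ} (hγ : γ ∈ valueGroup v) :
    γ ∈ valueGroup (restrict K v) ∨ γ - ξ ∈ valueGroup (restrict K v) := by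
  obtain ⟨y, hy⟩ := hγ
  obtain ⟨a, b, rfl⟩ := hspan y
  rw [map_add_mul_eq_min hξ hξK] at hy
  rcases min_choice (v (algebraMap K L a)) (v (algebraMap K L b * s)) with h | h
  · exact Or.inl ⟨a, h.symm.trans hy⟩
  · right
    rw [h, AddValuation.map_mul, hξ] at hy
    have hb : b ≠ 0 := by
      rintro rfl
      simp at hy
    obtain ⟨c, hc⟩ := exists_coe_eq (w := v) ((map_ne_zero (algebraMap K L)).2 hb)
    rw [hc, ← WithTop.coe_add, WithTop.coe_inj] at hy
    exact ⟨b, by rw [← hy, add_sub_cancel_right]; exact hc⟩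

theorem two_nsmul_mem_valueGroup {t : K} (hs : s ^ 2 = algebraMap K L t) (hξ : v s = ξ) :
    2 • ξ ∈ valueGroup (restrict K v) :=
  ⟨t, by
    change v (algebraMap K L t) = _
    rw [← hs, AddValuation.map_pow, hξ]; rfl⟩

theorem ramificationIndex_eq_two {t : K} (hs : s ^ 2 = algebraMap K L t)
    (hspan : ∀ y : L, ∃ a b : K, y = algebraMap K L a + algebraMap K L b * s)
    (hξ : v s = ξ) (hξK : ξ ∉ valueGroup (restrict K v)) : ramificationIndex K v = 2 := by
  rw [ramificationIndex, AddSubgroup.relIndex_eq_two_iff]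
  refine ⟨ξ, ⟨s, hξ⟩, fun b hb => ?_⟩
  rcases mem_or_sub_mem_valueGroup hspan hξ hξK hb with h | h
  · refine Or.inr ⟨h, fun h' => hξK ?_⟩
    simpa using sub_mem h' h
  · refine Or.inl ⟨?_, fun h' => hξK ?_⟩
    · convert add_mem h (two_nsmul_mem_valueGroup hs hξ) using 1
      rw [two_nsmul]; abel
    · simpa using sub_mem h' h

/-- In `y = a + b * s` the second term cannot have value 0, since `ξ ∉ νK`. So `a` has the residue
of `y`, and the residue field does not grow. -/
theorem exists_lt_map_sub (hspan : ∀ y : L, ∃ a b : K, y = algebraMap K L a + algebraMap K L b * s)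
    (hξ : v s = ξ) (hξK : ξ ∉ valueGroup (restrict K v)) {y : L} (hy : 0 ≤ v y) :
    ∃ a : K, 0 ≤ v (algebraMap K L a) ∧ 0 < v (y - algebraMap K L a) := by
  obtain ⟨a, b, rfl⟩ := hspan y
  rw [map_add_mul_eq_min hξ hξK, le_min_iff] at hy
  refine ⟨a, hy.1, ?_⟩
  rw [add_sub_cancel_left]
  refine lt_of_le_of_ne hy.2 fun h => hξK ?_
  have hb : b ≠ 0 := by
    rintro rfl
    simp at h
  obtain ⟨c, d, hc, hd, rfl⟩ := coe_mem_valueGroup_of_add_eq hξ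
    ((map_ne_zero (algebraMap K L)).2 hb) (y := 1) (by rw [← h, AddValuation.map_one]) one_ne_zero
  exact sub_mem ⟨1, by simpa using hd⟩ ⟨b, hc⟩

theorem exists_algebraMap_residueField_eq
    (h : ∀ y : L, 0 ≤ v y → ∃ a : K, 0 ≤ v (algebraMap K L a) ∧ 0 < v (y - algebraMap K L a))
    (z : residueField v) :
    ∃ a : residueField (restrict K v), algebraMap _ (residueField v) a = z := by
  obtain ⟨y, rfl⟩ := IsLocalRing.residue_surjective z
  obtain ⟨a, ha, hya⟩ := h y y.2
  refine ⟨IsLocalRing.residue _ ⟨a, ha⟩, ?_⟩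
  change IsLocalRing.residue (valuationRing v) ⟨algebraMap K L a, ha⟩ = _
  rw [← sub_eq_zero, ← map_sub, IsLocalRing.residue_eq_zero_iff,
    ← ValuationSubring.coe_mem_nonunits_iff, mem_nonunits_iff, AddSubgroupClass.coe_sub,
    AddValuation.map_sub_swap]
  exact hya

theorem residueDegree_eq_one
    (h : ∀ y : L, 0 ≤ v y → ∃ a : K, 0 ≤ v (algebraMap K L a) ∧ 0 < v (y - algebraMap K L a)) :
    residueDegree K v = 1 :=
  (finrank_eq_one_iff_of_nonzero' (1 : residueField v) one_ne_zero).2 fun z => by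
    obtain ⟨a, rfl⟩ := exists_algebraMap_residueField_eq h z
    exact ⟨a, by rw [Algebra.smul_def, mul_one]⟩

theorem isSeparable_residueField
    (h : ∀ y : L, 0 ≤ v y → ∃ a : K, 0 ≤ v (algebraMap K L a) ∧ 0 < v (y - algebraMap K L a)) :
    Algebra.IsSeparable (residueField (restrict K v)) (residueField v) :=
  ⟨fun z => by
    obtain ⟨a, rfl⟩ := exists_algebraMap_residueField_eq h z
    exact isSeparable_algebraMap a⟩

theorem ramificationIndex_eq_one_of_surjective (h : Function.Surjective (algebraMap K L)) :
    ramificationIndex K v = 1 := by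
  rw [ramificationIndex, AddSubgroup.relIndex_eq_one]
  rintro γ ⟨y, hy⟩
  obtain ⟨x, rfl⟩ := h y
  exact ⟨x, hy⟩

theorem coprime_ringExpChar_two {k : Type*} [Field k] (h2 : (2 : k) ≠ 0) :
    (ringExpChar k).Coprime 2 := by
  rw [Nat.coprime_comm, Nat.Prime.coprime_iff_not_dvd Nat.prime_two]
  intro hdvd
  rcases expChar_is_prime_or_one k (ringExpChar k) with hp | hp
  · have heq := (Nat.prime_dvd_prime_iff_eq Nat.prime_two hp).1 hdvd
    have hchar : ringChar k = 2 := by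
      rw [ringExpChar] at heq
      lia
    exact h2 (by simpa [hchar] using ringChar.Nat.cast_ringChar (R := k))
  · rw [hp] at hdvd
    exact absurd hdvd (by decide)

theorem two_ne_zero_residueField (h2 : v (2 : L) = 0) : (2 : residueField v) ≠ 0 := by
  have : (2 : residueField v) = IsLocalRing.residue (valuationRing v) 2 := (map_ofNat _ 2).symm
  rw [this, Ne, IsLocalRing.residue_eq_zero_iff, ← ValuationSubring.coe_mem_nonunits_iff,
    mem_nonunits_iff]
  exact fun h => (h.trans_eq h2).false

/-- A ramified quadratic extension generated by a square root is tame in residue characteristic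
different from `2`. -/
theorem isTame_of_sq_eq {t : K} (hs : s ^ 2 = algebraMap K L t)
    (hspan : ∀ y : L, ∃ a b : K, y = algebraMap K L a + algebraMap K L b * s)
    (hξ : v s = ξ) (hξK : ξ ∉ valueGroup (restrict K v)) (h2 : v (2 : L) = 0)
    (hrank : Module.finrank K L = 2) : IsTame K v := by
  intro E hE
  have hdvd : Module.finrank K E ∣ 2 := ⟨_, by rw [← hrank, Module.finrank_mul_finrank K E L]⟩
  -- The degree is 2, so the only subextensions to test are the base and the whole field.
  rcases (Nat.dvd_prime Nat.prime_two).1 hdvd with h | h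
  · have hbot : E = ⊥ := IntermediateField.finrank_eq_one_iff.1 h
    have hsurj : Function.Surjective (algebraMap K E) := by
      rintro ⟨y, hy⟩
      rw [hbot, IntermediateField.mem_bot] at hy
      obtain ⟨x, hx⟩ := hy
      exact ⟨x, Subtype.ext hx⟩
    have hres : ∀ y : E, 0 ≤ restrict E v y →
        ∃ a : K, 0 ≤ restrict E v (algebraMap K E a) ∧ 0 < restrict E v (y - algebraMap K E a) := by
      intro y hy
      obtain ⟨x, rfl⟩ := hsurj y
      exact ⟨x, hy, by simp⟩
    rw [h, ramificationIndex_eq_one_of_surjective hsurj, residueDegree_eq_one hres]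
    exact ⟨Nat.coprime_one_right _, isSeparable_residueField hres, rfl⟩
  · have : FiniteDimensional K L := Module.finite_of_finrank_eq_succ hrank
    have htop : E = ⊤ := by
      apply IntermediateField.eq_of_le_of_finrank_eq le_top
      rw [h, IntermediateField.finrank_top', hrank]
    have hsE : s ∈ E := htop ▸ IntermediateField.mem_top
    have hspanE : ∀ y : E, ∃ a b : K, y = algebraMap K E a + algebraMap K E b * ⟨s, hsE⟩ := by
      intro y
      obtain ⟨a, b, hab⟩ := hspan y
      exact ⟨a, b, Subtype.ext hab⟩
    have hξE : restrict E v ⟨s, hsE⟩ = ξ := hξ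
    have hres := fun (y : E) (hy : 0 ≤ restrict E v y) => exists_lt_map_sub hspanE hξE hξK hy
    rw [h, ramificationIndex_eq_two (t := t) (Subtype.ext hs) hspanE hξE hξK,
      residueDegree_eq_one hres]
    refine ⟨coprime_ringExpChar_two (two_ne_zero_residueField ?_), isSeparable_residueField hres,
      rfl⟩
    change v (algebraMap K L 2) = 0
    rwa [map_ofNat]

variable {Ω : Type*} [Field Ω] [Algebra K Ω]

theorem exists_eq_add_mul_of_mem_adjoin {s : Ω} {t : K} (hs : s ^ 2 = algebraMap K Ω t)
    (y : IntermediateField.adjoin K {s}) : ∃ a b : K,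
      y = algebraMap K _ a + algebraMap K _ b * IntermediateField.AdjoinSimple.gen K s := by
  have hint : IsIntegral K s := IsIntegral.of_pow two_pos (hs ▸ isIntegral_algebraMap)
  have hy : (y : Ω) ∈ Algebra.adjoin K {s} := by
    rw [← IntermediateField.adjoin_simple_toSubalgebra_of_isAlgebraic hint.isAlgebraic]
    exact y.2
  obtain ⟨y, hyL⟩ := y
  suffices ∃ a b : K, y = algebraMap K Ω a + algebraMap K Ω b * s by
    obtain ⟨a, b, h⟩ := this
    exact ⟨a, b, Subtype.ext h⟩
  replace hy : y ∈ Algebra.adjoin K {s} := hy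
  clear hyL
  induction hy using Algebra.adjoin_induction with
  | mem x hx => exact ⟨0, 1, by simp [Set.mem_singleton_iff.1 hx]⟩
  | algebraMap r => exact ⟨r, 0, by simp⟩
  | add x y _ _ hx hy =>
    obtain ⟨a, b, rfl⟩ := hx
    obtain ⟨c, d, rfl⟩ := hy
    exact ⟨a + c, b + d, by simp only [map_add]; ring⟩
  | mul x y _ _ hx hy =>
    obtain ⟨a, b, rfl⟩ := hx
    obtain ⟨c, d, rfl⟩ := hy
    refine ⟨a * c + b * d * t, a * d + b * c, ?_⟩
    simp only [map_add, map_mul, ← hs]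
    ring

theorem finrank_adjoin_eq_two {s : Ω} {t : K} (hs : s ^ 2 = algebraMap K Ω t)
    (hsK : s ∉ (algebraMap K Ω).range) :
    Module.finrank K (IntermediateField.adjoin K {s}) = 2 := by
  have hint : IsIntegral K s := IsIntegral.of_pow two_pos (hs ▸ isIntegral_algebraMap)
  rw [IntermediateField.adjoin.finrank hint]
  refine le_antisymm ?_ ((minpoly.two_le_natDegree_iff hint).2 hsK)
  have h := minpoly.degree_le_of_ne_zero K s (p := Polynomial.X ^ 2 - Polynomial.C t)
    (Polynomial.X_pow_sub_C_ne_zero two_pos t) (by simp [hs])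
  rw [Polynomial.degree_X_pow_sub_C two_pos] at h
  exact Polynomial.natDegree_le_of_degree_le h

end Quadratic

end ValuedField

/-! ### Parity of values in the lexicographic group. -/

namespace LexValuation

open ValuedField

section

variable {k : Type*} [Field k]

theorem polyVal_X (i : Fin 2) :
    polyVal (MvPolynomial.X i : MvPolynomial (Fin 2) k) = lexExp (Finsupp.single i 1) := by
  rw [polyVal, MvPolynomial.support_X, Finset.inf_singleton]

theorem lexVal_varX : lexVal k (varX k) = ((toLex (1, 0) : ℤ ×ₗ ℤ) : WithTop (ℤ ×ₗ ℤ)) := by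
  rw [varX, lexVal_algebraMap, polyVal_X]
  simp [lexExp]

theorem lexVal_varY : lexVal k (varY k) = ((toLex (0, 1) : ℤ ×ₗ ℤ) : WithTop (ℤ ×ₗ ℤ)) := by
  rw [varY, lexVal_algebraMap, polyVal_X]
  simp [lexExp]

theorem lexVal_two (hk : ringChar k ≠ 2) : lexVal k 2 = 0 := by
  classical
  have h2 : (2 : k) ≠ 0 := Ring.two_ne_zero hk
  have h : (2 : RatFun k) = algebraMap (MvPolynomial (Fin 2) k) (RatFun k) (MvPolynomial.C 2) := by
    rw [map_ofNat, map_ofNat]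
  rw [h, lexVal_algebraMap, polyVal, MvPolynomial.C_apply, MvPolynomial.support_monomial, if_neg h2,
    Finset.inf_singleton]
  rfl

theorem lexVal_sq_ne_varX (f : RatFun k) : lexVal k (f ^ 2) ≠ lexVal k (varX k) := by
  intro h
  by_cases hf : f = 0
  · simp [hf, lexVal_varX] at h
  obtain ⟨γ, hγ⟩ := exists_coe_eq (w := lexVal k) hf
  rw [pow_two, AddValuation.map_mul, hγ, lexVal_varX, ← WithTop.coe_add, WithTop.coe_inj] at h
  have := congrArg (fun z => (ofLex z).1) h
  simp at this
  lia

theorem lexVal_sq_ne_varY (f : RatFun k) : lexVal k (f ^ 2) ≠ lexVal k (varY k) := by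
  intro h
  by_cases hf : f = 0
  · simp [hf, lexVal_varY] at h
  obtain ⟨γ, hγ⟩ := exists_coe_eq (w := lexVal k) hf
  rw [pow_two, AddValuation.map_mul, hγ, lexVal_varY, ← WithTop.coe_add, WithTop.coe_inj] at h
  have := congrArg (fun z => (ofLex z).2) h
  simp at this
  lia

/-- Multiplying by `Y` leaves the first coordinate of `ν(f ^ 2)` even, while that of `ν(X)` is 1.
This is what keeps `√X` and `√Y` in independent classes. -/
theorem lexVal_sq_mul_varY_ne_varX (f : RatFun k) :
    lexVal k (f ^ 2 * varY k) ≠ lexVal k (varX k) := by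
  intro h
  by_cases hf : f = 0
  · simp [hf, lexVal_varX] at h
  obtain ⟨γ, hγ⟩ := exists_coe_eq (w := lexVal k) hf
  rw [pow_two, AddValuation.map_mul, AddValuation.map_mul, hγ, lexVal_varX, lexVal_varY,
    ← WithTop.coe_add, ← WithTop.coe_add, WithTop.coe_inj] at h
  have := congrArg (fun z => (ofLex z).1) h
  simp at this
  lia

variable {Ω : Type*} [Field Ω] [Algebra (RatFun k) Ω] {Γ : Type*} [AddCommGroup Γ] [LinearOrder Γ]
  [IsOrderedAddMonoid Γ] {w : AddValuation Ω (WithTop Γ)}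

/-- As `w` extends `ν` only up to equivalence, this transfers parity arguments from ℤ ⊕ ℤ to `Γ`. -/
theorem map_eq_map_iff (hw : Extends (lexVal k) w) (f g : RatFun k) :
    w (algebraMap _ Ω f) = w (algebraMap _ Ω g) ↔ lexVal k f = lexVal k g :=
  (AddValuation.IsEquiv.val_eq hw).symm

variable [IsAlgClosure (RatFun k) Ω]

theorem exists_of_mem_valueGroup_henselization {γ : Γ}
    (hγ : γ ∈ valueGroup (restrict (henselization (RatFun k) w) w)) :
    ∃ f : RatFun k, w (algebraMap _ Ω f) = γ := by
  obtain ⟨x, hx⟩ := hγ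
  have : IsAlgClosed Ω := IsAlgClosure.isAlgClosed (RatFun k)
  have : Algebra.IsAlgebraic (RatFun k) Ω := IsAlgClosure.isAlgebraic
  have hx' : w (x : Ω) = γ := hx
  have hx0 : (x : Ω) ≠ 0 := by
    intro h
    simp [h] at hx'
  obtain ⟨a, ha⟩ := exists_algebraMap_eq_of_mem_henselization w x.2 hx0
  exact ⟨a, ha.trans hx'⟩

variable {sX sY : Ω} {ξ η : Γ}

theorem map_sqrt_notMem_valueGroup {f : RatFun k} {s : Ω} (hw : Extends (lexVal k) w)
    (hs : s ^ 2 = algebraMap (RatFun k) Ω f) (hξ : w s = ξ)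
    (hf : ∀ g, lexVal k (g ^ 2) ≠ lexVal k f) :
    ξ ∉ valueGroup (restrict (henselization (RatFun k) w) w) := by
  intro h
  obtain ⟨g, hg⟩ := exists_of_mem_valueGroup_henselization h
  refine hf g ((map_eq_map_iff hw _ _).1 ?_)
  rw [← hs, map_pow, AddValuation.map_pow, AddValuation.map_pow, hg, hξ]

/-- If `ξ - η` were the value of some `g` in `k(X, Y)`, doubling would give `ν(g ^ 2 * Y) = ν(X)`.
-/
theorem map_sqrtX_sub_notMem_valueGroup (hw : Extends (lexVal k) w)
    (hX : sX ^ 2 = algebraMap (RatFun k) Ω (varX k))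
    (hY : sY ^ 2 = algebraMap (RatFun k) Ω (varY k)) (hξ : w sX = ξ) (hη : w sY = η) :
    ξ - η ∉ valueGroup (restrict (henselization (RatFun k) w) w) := by
  intro h
  obtain ⟨g, hg⟩ := exists_of_mem_valueGroup_henselization h
  refine lexVal_sq_mul_varY_ne_varX g ((map_eq_map_iff hw _ _).1 ?_)
  rw [← hX, map_mul, map_pow, ← hY, ← mul_pow, AddValuation.map_pow, AddValuation.map_pow,
    AddValuation.map_mul, hg, hξ, hη, ← WithTop.coe_add, sub_add_cancel]

end

end LexValuation

open LexValuation ValuedField in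
theorem mainTheorem5
    {k : Type*} [Field k] (hk : ringChar k ≠ 2)
    {Ω : Type*} [Field Ω] [Algebra (RatFun k) Ω] [IsAlgClosure (RatFun k) Ω]
    {Γ : Type*} [AddCommGroup Γ] [LinearOrder Γ] [IsOrderedAddMonoid Γ]
    (w : AddValuation Ω (WithTop Γ)) (hw : Extends (lexVal k) w)
    (sX sY : Ω) (hX : sX ^ 2 = algebraMap (RatFun k) Ω (varX k))
    (hY : sY ^ 2 = algebraMap (RatFun k) Ω (varY k))
    (K : IntermediateField (RatFun k) Ω) (hK : K = henselization (RatFun k) w)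
    (L₁ L₂ : IntermediateField K Ω) (hL₁ : L₁ = IntermediateField.adjoin K {sX})
    (hL₂ : L₂ = IntermediateField.adjoin K {sY})
    (L : IntermediateField L₂ Ω)
    (hL : L = IntermediateField.extendScalars (le_sup_right : L₂ ≤ L₁ ⊔ L₂)) :
    IsHenselian (restrict K w) ∧
    FiniteDimensional K L₁ ∧ IsTame K (restrict L₁ w) ∧ FiniteDimensional K L₂ ∧
    ramificationIndex K (restrict L₁ w) = 2 ∧
    ramificationIndex K (restrict L₂ w) = 2 ∧
    ¬ IsUnramified L₂ (restrict L w) := by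
  have : IsAlgClosed Ω := IsAlgClosure.isAlgClosed (RatFun k)
  have hw2 : w (2 : Ω) = 0 := by
    rw [← AddValuation.map_one w, ← map_one (algebraMap (RatFun k) Ω),
      ← map_ofNat (algebraMap (RatFun k) Ω) 2, map_eq_map_iff hw, AddValuation.map_one]
    exact lexVal_two hk
  have hsX0 : sX ≠ 0 := by
    rintro rfl
    refine lexVal_sq_ne_varX (k := k) 0 ((map_eq_map_iff hw _ _).1 ?_)
    rw [← hX, map_pow, map_zero]
  have hsY0 : sY ≠ 0 := by
    rintro rfl
    refine lexVal_sq_ne_varY (k := k) 0 ((map_eq_map_iff hw _ _).1 ?_)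
    rw [← hY, map_pow, map_zero]
  obtain ⟨ξ, hξ⟩ := exists_coe_eq (w := w) hsX0
  obtain ⟨η, hη⟩ := exists_coe_eq (w := w) hsY0
  have hξK := map_sqrt_notMem_valueGroup hw hX hξ lexVal_sq_ne_varX
  have hηK := map_sqrt_notMem_valueGroup hw hY hη lexVal_sq_ne_varY
  have hξηK := map_sqrtX_sub_notMem_valueGroup hw hX hY hξ hη
  rw [← hK] at hξK hηK hξηK
  have hXK : sX ^ 2 = algebraMap K Ω (algebraMap (RatFun k) K (varX k)) := hX
  have hYK : sY ^ 2 = algebraMap K Ω (algebraMap (RatFun k) K (varY k)) := hY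
  have hrank₁ := finrank_adjoin_eq_two hXK (by rintro ⟨x, rfl⟩; exact hξK ⟨x, hξ⟩)
  have hrank₂ := finrank_adjoin_eq_two hYK (by rintro ⟨x, rfl⟩; exact hηK ⟨x, hη⟩)
  have hspan₁ := exists_eq_add_mul_of_mem_adjoin hXK
  have hspan₂ := exists_eq_add_mul_of_mem_adjoin hYK
  rw [← hL₁] at hrank₁
  rw [← hL₂] at hrank₂
  refine ⟨hK ▸ isHenselian_henselization w, Module.finite_of_finrank_eq_succ hrank₁, ?_,
    Module.finite_of_finrank_eq_succ hrank₂, ?_, ?_, fun hunr => ?_⟩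
  · subst hL₁
    refine isTame_of_sq_eq (Subtype.ext hXK) hspan₁ (ξ := ξ) hξ hξK ?_ hrank₁
    change w (algebraMap _ Ω 2) = 0
    rwa [map_ofNat]
  · subst hL₁
    exact ramificationIndex_eq_two (Subtype.ext hXK) hspan₁ (ξ := ξ) hξ hξK
  · subst hL₂
    exact ramificationIndex_eq_two (Subtype.ext hYK) hspan₂ (ξ := η) hη hηK
  · have hsX : sX ∈ L := by
      rw [hL, IntermediateField.mem_extendScalars]
      refine (le_sup_left : L₁ ≤ L₁ ⊔ L₂) ?_
      rw [hL₁]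
      exact IntermediateField.mem_adjoin_simple_self K sX
    have h1 : ξ ∈ valueGroup (restrict L w) := ⟨⟨sX, hsX⟩, hξ⟩
    -- Only the equality of value groups is contradicted: it would put `ξ` in `ν L₂`, hence `ξ` or
    -- `ξ - η` in `νK`.
    rw [hunr.2] at h1
    obtain ⟨y, hy⟩ := h1
    subst hL₂
    rcases mem_or_sub_mem_valueGroup (v := restrict (IntermediateField.adjoin K {sY}) w)
      hspan₂ (ξ := η) hη hηK ⟨y, hy⟩ with h | h
    · exact hξK h
    · exact hξηK h
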